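/- Let $S=\bigoplus_{n\ge 0}S_n$ be a Noetherian $\mathbb{N}$-graded commutative ring whose degree-zero part $S_0$ is local with residue field $\mathbb{k}$ (possibly $S=S_0$). For $a\in\mathbb{Z}$ let $\operatorname{DM}(S,a)$ be the category of degree-$a$ graded differential modules: $\mathbb{Z}$-graded $S$-modules $D$ with an $S$-linear map $d\colon D\to D$, $d^2=0$, $d(D_n)\subseteq D_{n+a}$; morphisms are degree-preserving $S$-linear maps commuting with $d$. The homology $H(D)=\ker d/\operatorname{im} d$ is graded by the degrees of cycles, and a quasi-isomorphism is a morphism inducing an isomorphism on homology. A free flag is an object $F=\bigoplus_{i\ge 0}F_i$ of $\operatorname{DM}(S,a)$ with every $F_i$ graded free and $d(F_i)\subseteq\bigoplus_{j<i}F_j$. A minimal free resolution of $D$ is a quasi-isomorphism $M\to D$ with $M$ graded free and $d^M\otimes_S\mathbb{k}=0$ that factors in $\operatorname{DM}(S,a)$ as a split injection $M\to F$ followed by a quasi-isomorphism $F\to D$ from a free flag $F$. The Betti numbers of $D$ are $\beta_j(D)=\dim_{\mathbb{k}}H(M\otimes_S\mathbb{k})_j$ for a minimal free resolution $M\to D$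 (they do not depend on its choice), and $\beta(D)=\sum_{j\in\mathbb{Z}}\beta_j(D)$. We call $D$ Betti-deficient if $D$ and $H(D)$ have minimal free resolutions and $\beta(D)<\beta(H(D))$, where $H(D)$ is viewed as an object of $\operatorname{DM}(S,a)$ with zero differential. Let $I\subsetneq S$ be the ideal generated by a regular sequence $f_1,\dots,f_\ell$ of homogeneous elements, with $f_i$ of degree $d_i$. If there is a Betti-deficient $D\in\operatorname{DM}(S,a)$ with $H(D)\cong S/I$ as graded $S$-modules, then there are subsets $J_1,J_2\subseteq\{1,\dots,\ell\}$ and an integer $j$ with $2\le j\le\ell$ such that $|J_2|=|J_1|+j$ and $$\sum_{r\in J_1}d_r-\sum_{r\in J_2}d_r=a-aj.$$ -/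

import Mathlib

universe u

namespace DiffMod

/-- Additive projections that split a family of subgroups spanning `M` show that `M` is the
internal direct sum of the family. -/
theorem isInternal_of_proj {M : Type*} [AddCommGroup M] (A : ℤ → AddSubgroup M)
    (π : ℤ → M →+ M) (h1 : ∀ n x, x ∈ A n → π n x = x)
    (h2 : ∀ n m x, x ∈ A m → m ≠ n → π n x = 0) (h3 : ∀ x, x ∈ ⨆ n, A n) :
    DirectSum.IsInternal A := by
  constructor
  · rw [injective_iff_map_eq_zero]
    intro z hz
    have key : ∀ n, ∀ z : DirectSum ℤ fun i => A i,
        π n (DirectSum.coeAddMonoidHom A z) = z n := by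
      intro n z
      induction z using DirectSum.induction_on with
      | zero => simp
      | of i x =>
        rw [DirectSum.coeAddMonoidHom_of]
        by_cases h : i = n
        · subst h
          rw [DirectSum.of_eq_same]
          exact h1 _ _ x.2
        · rw [DirectSum.of_eq_of_ne _ _ _ (Ne.symm h)]
          exact h2 _ _ _ x.2 h
      | add x y hx hy => simp [hx, hy]
    ext n
    rw [← key n z, hz]
    simp
  · intro x
    refine AddSubgroup.iSup_induction A
      (C := fun x => ∃ a, DirectSum.coeAddMonoidHom A a = x) (h3 x) ?_ ?_ ?_
    · intro i x hx
      exact ⟨DirectSum.of (fun i => A i) i ⟨x, hx⟩, DirectSum.coeAddMonoidHom_of _ _ _⟩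
    · exact ⟨0, map_zero _⟩
    · rintro x y ⟨a, rfl⟩ ⟨b, rfl⟩
      exact ⟨a + b, map_add _ _ _⟩

section General

variable {R : Type*} [CommRing R] {M : Type*} [AddCommGroup M] [Module R M]

/-- The homology `ker f / im f` of an endomorphism `f` (used when `f ∘ f = 0`). -/
abbrev Homology (f : M →ₗ[R] M) : Type _ :=
  LinearMap.ker f ⧸ (LinearMap.range f).submoduleOf (LinearMap.ker f)

/-- The class in `ker f / im f` of a cycle. -/
abbrev homologyMk (f : M →ₗ[R] M) : LinearMap.ker f →ₗ[R] Homology f :=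
  ((LinearMap.range f).submoduleOf (LinearMap.ker f)).mkQ

/-- The map induced on homology by a linear map commuting with the endomorphisms. -/
def homologyMap {N : Type*} [AddCommGroup N] [Module R N] (f : M →ₗ[R] M) (g : N →ₗ[R] N)
    (φ : M →ₗ[R] N) (h : g ∘ₗ φ = φ ∘ₗ f) : Homology f →ₗ[R] Homology g :=
  Submodule.mapQ _ _
    (φ.restrict (p := LinearMap.ker f) (q := LinearMap.ker g) (fun x hx => by
      have := LinearMap.congr_fun h x
      simp only [LinearMap.comp_apply] at this
      rw [LinearMap.mem_ker] at hx ⊢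
      rw [this, hx, map_zero]))
    (by
      rintro ⟨x, hx⟩ ⟨y, hy⟩
      exact ⟨φ y, by
        have := LinearMap.congr_fun h y
        simp only [LinearMap.comp_apply] at this
        rw [this, hy]
        rfl⟩)

end General

variable {S : Type u} [CommRing S] (𝒮 : ℕ → AddSubgroup S) [GradedRing 𝒮]

/-- The ideal `𝔪₀ ⊕ S₁ ⊕ S₂ ⊕ ⋯` of the `ℕ`-graded ring `S`, where `𝔪₀` is the maximal ideal of
the local ring `S₀`. -/
def gradedMaximalIdeal [IsLocalRing (𝒮 0)] : Ideal S :=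
  (IsLocalRing.maximalIdeal (𝒮 0)).comap (GradedRing.projZeroRingHom' 𝒮)

/-- The residue field `𝕜 = S₀ / 𝔪₀`, viewed as the `S`-algebra `S / (𝔪₀ ⊕ S₁ ⊕ S₂ ⊕ ⋯)`
(concentrated in degree `0`). -/
abbrev ResField [IsLocalRing (𝒮 0)] : Type u := S ⧸ gradedMaximalIdeal 𝒮

/-- The `ℤ`-grading on `S / I` induced by the `ℕ`-grading of `S` (`I` a homogeneous ideal). -/
def quotGr (I : Ideal S) : ℤ → AddSubgroup (S ⧸ I)
  | Int.ofNat n => (𝒮 n).map (Ideal.Quotient.mk I : S →+* S ⧸ I).toAddMonoidHom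
  | Int.negSucc _ => ⊥

/-- A graded differential `S`-module of degree `a`, that is, an object of `DM(S, a)`: a `ℤ`-graded
`S`-module with a square-zero `S`-linear endomorphism `d` carrying degree `n` to degree `n + a`. -/
structure DM (a : ℤ) where
  /-- The underlying module. -/
  carrier : Type u
  [addCommGroup : AddCommGroup carrier]
  [module : Module S carrier]
  /-- The homogeneous components. -/
  gr : ℤ → AddSubgroup carrier
  isInternal : DirectSum.IsInternal gr
  smul_mem : ∀ (m : ℕ) (n : ℤ) (s : S) (x : carrier), s ∈ 𝒮 m → x ∈ gr n → s • x ∈ gr (m + n)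
  /-- The differential. -/
  d : carrier →ₗ[S] carrier
  d_mem : ∀ (n : ℤ) (x : carrier), x ∈ gr n → d x ∈ gr (n + a)
  d_comp_d : d ∘ₗ d = 0

attribute [instance] DM.addCommGroup DM.module

variable {𝒮} {a : ℤ}

/-- The degree `n` component of the homology: the classes of the cycles of degree `n`. -/
def DM.homologyGr (D : DM 𝒮 a) (n : ℤ) : AddSubgroup (Homology D.d) :=
  ((D.gr n).comap (LinearMap.ker D.d).subtype.toAddMonoidHom).map (homologyMk D.d).toAddMonoidHom

theorem DM.homologyGr_isInternal (D : DM 𝒮 a) : DirectSum.IsInternal D.homologyGr := by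
  classical
  let _ := D.isInternal.chooseDecomposition
  -- the differential shifts homogeneous components by `a`
  have hd : ∀ (n : ℤ) (x : D.carrier),
      (DirectSum.decompose D.gr (D.d x) (n + a) : D.carrier)
        = D.d (DirectSum.decompose D.gr x n : D.carrier) := by
    intro n x
    induction x using DirectSum.Decomposition.inductionOn D.gr with
    | zero => simp
    | @homogeneous i m =>
      by_cases h : i = n
      · subst h
        rw [DirectSum.decompose_of_mem_same _ (D.d_mem _ _ m.2),
          DirectSum.decompose_of_mem_same _ m.2]
      · rw [DirectSum.decompose_of_mem_ne _ (D.d_mem _ _ m.2) (by omega),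
          DirectSum.decompose_of_mem_ne _ m.2 h, map_zero]
    | add x y hx hy => simp [DirectSum.decompose_add, hx, hy]
  have hker : ∀ (n : ℤ) (x : LinearMap.ker D.d),
      (DirectSum.decompose D.gr (x : D.carrier) n : D.carrier) ∈ LinearMap.ker D.d := by
    intro n x
    rw [LinearMap.mem_ker, ← hd, LinearMap.mem_ker.1 x.2]
    simp
  let p : ℤ → (LinearMap.ker D.d →+ LinearMap.ker D.d) := fun n =>
    { toFun := fun x => ⟨_, hker n x⟩
      map_zero' := by ext; simp
      map_add' := by intro x y; ext; simp [DirectSum.decompose_add] }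
  let P := (LinearMap.range D.d).submoduleOf (LinearMap.ker D.d)
  have hp : ∀ n x, x ∈ P → p n x ∈ P := by
    rintro n x ⟨y, hy⟩
    refine ⟨(DirectSum.decompose D.gr y (n - a) : D.carrier), ?_⟩
    rw [← hd, hy, sub_add_cancel]
    rfl
  let π : ℤ → (Homology D.d →+ Homology D.d) := fun n =>
    QuotientAddGroup.map P.toAddSubgroup P.toAddSubgroup (p n) (hp n)
  have hπ : ∀ n x, π n (homologyMk D.d x) = homologyMk D.d (p n x) := fun n x => rfl
  refine isInternal_of_proj _ π ?_ ?_ ?_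
  · rintro n _ ⟨x, hx, rfl⟩
    refine (hπ n x).trans (congrArg _ (Subtype.ext ?_))
    exact DirectSum.decompose_of_mem_same _ hx
  · rintro n m _ ⟨x, hx, rfl⟩ hmn
    refine (hπ n x).trans ?_
    have : p n x = 0 := Subtype.ext (DirectSum.decompose_of_mem_ne _ hx hmn)
    rw [this, map_zero]
  · intro x
    obtain ⟨x, rfl⟩ := Submodule.mkQ_surjective _ x
    have hx : x = ∑ i ∈ (DirectSum.decompose D.gr (x : D.carrier)).support, p i x := by
      ext
      rw [AddSubmonoidClass.coe_finsetSum]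
      exact (DirectSum.sum_support_decompose D.gr (x : D.carrier)).symm
    rw [hx, map_sum]
    refine sum_mem fun i _ => AddSubgroup.mem_iSup_of_mem i ⟨p i x, ?_, rfl⟩
    exact (DirectSum.decompose D.gr (x : D.carrier) i).2

/-- The homology `H(D) = ker d / im d`, a graded `S`-module, viewed as an object of `DM(S, a)` with
zero differential. -/
def DM.H (D : DM 𝒮 a) : DM 𝒮 a where
  carrier := Homology D.d
  gr := D.homologyGr
  isInternal := D.homologyGr_isInternal
  smul_mem := by
    rintro m n s _ hs ⟨x, hx, rfl⟩
    exact ⟨s • x, D.smul_mem m n s _ hs hx, rfl⟩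
  d := 0
  d_mem := fun n x _ => by simp
  d_comp_d := by simp

/-- The homology of `D` is `S / I`: there is a degree-preserving `S`-linear isomorphism between
them. -/
def DM.HomologyIso (D : DM 𝒮 a) (I : Ideal S) : Prop :=
  ∃ e : D.H.carrier ≃ₗ[S] (S ⧸ I), ∀ (n : ℤ) (x : D.H.carrier),
    x ∈ D.H.gr n ↔ e x ∈ quotGr 𝒮 I n

/-- A morphism in `DM(S, a)`: a degree-preserving `S`-linear map commuting with differentials. -/
structure DM.Hom (D E : DM 𝒮 a) where
  /-- The underlying linear map. -/
  toLin : D.carrier →ₗ[S] E.carrier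
  map_mem : ∀ (n : ℤ) (x : D.carrier), x ∈ D.gr n → toLin x ∈ E.gr n
  comm : E.d ∘ₗ toLin = toLin ∘ₗ D.d

/-- A morphism is a quasi-isomorphism if it induces an isomorphism on homology. -/
def DM.Hom.IsQuasiIso {D E : DM 𝒮 a} (φ : DM.Hom D E) : Prop :=
  Function.Bijective (homologyMap D.d E.d φ.toLin φ.comm)

/-- The submodule `N` of `F` is graded free: it has an `S`-basis of homogeneous elements of `F`. -/
def DM.GradedFree (F : DM 𝒮 a) (N : Submodule S F.carrier) : Prop :=
  ∃ B : Set F.carrier, (∀ x ∈ B, ∃ n, x ∈ F.gr n) ∧ LinearIndepOn S id B ∧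
    Submodule.span S B = N

/-- `F` is a free flag: `F = ⨁ᵢ Fᵢ` (`i ≥ 0`) with each `Fᵢ` graded free and
`d(Fᵢ) ⊆ ⨁_{j < i} Fⱼ`. -/
def DM.IsFreeFlag (F : DM 𝒮 a) : Prop :=
  ∃ P : ℕ → Submodule S F.carrier, DirectSum.IsInternal P ∧ (∀ i, F.GradedFree (P i)) ∧
    ∀ i, (P i).map F.d ≤ ⨆ j < i, P j

variable [IsLocalRing (𝒮 0)]

/-- The differential of `F ⊗ 𝕜`. -/
abbrev DM.fiberD (F : DM 𝒮 a) :
    TensorProduct S (ResField 𝒮) F.carrier →ₗ[ResField 𝒮]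
      TensorProduct S (ResField 𝒮) F.carrier :=
  F.d.baseChange (ResField 𝒮)

/-- The degree `n` component of `F ⊗ 𝕜`, spanned by the `1 ⊗ x` with `x` of degree `n`. -/
def DM.fiberGr (F : DM 𝒮 a) (n : ℤ) :
    Submodule (ResField 𝒮) (TensorProduct S (ResField 𝒮) F.carrier) :=
  Submodule.span (ResField 𝒮) ((fun x => (1 : ResField 𝒮) ⊗ₜ[S] x) '' (F.gr n : Set F.carrier))

/-- The degree `n` component of `H(F ⊗ 𝕜)`. -/
def DM.fiberHomologyGr (F : DM 𝒮 a) (n : ℤ) : Submodule (ResField 𝒮) (Homology F.fiberD) :=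
  ((F.fiberGr n).submoduleOf (LinearMap.ker F.fiberD)).map (homologyMk F.fiberD)

/-- `F` is minimal: `d ⊗ 𝕜 = 0`. -/
def DM.IsMinimal (F : DM 𝒮 a) : Prop := F.fiberD = 0

/-- `ε : M → D` is a minimal free resolution: `M` is free and minimal, `ε` is a quasi-isomorphism,
and `ε` factors as a split injection `M → F` in `DM(S, a)` followed by a free flag resolution
`F → D`, i.e. a quasi-isomorphism from a free flag. -/
def DM.Hom.IsMinimalFreeResolution {M D : DM 𝒮 a} (ε : DM.Hom M D) : Prop :=
  M.GradedFree ⊤ ∧ M.IsMinimal ∧ ε.IsQuasiIso ∧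
    ∃ (F : DM 𝒮 a) (φ : DM.Hom F D) (ι : DM.Hom M F) (r : DM.Hom F M),
      F.IsFreeFlag ∧ φ.IsQuasiIso ∧ r.toLin ∘ₗ ι.toLin = LinearMap.id ∧
        φ.toLin ∘ₗ ι.toLin = ε.toLin

/-- `D.HasBetti b`: some minimal free resolution `F` of `D` has
`dim H(F ⊗ 𝕜)ⱼ = b j` for all `j`, i.e. `b j` is the `j`-th Betti number of `D`. (Minimal free
resolutions are unique up to isomorphism, so `b` is determined by `D`.) -/
def DM.HasBetti (D : DM 𝒮 a) (b : ℤ → Cardinal.{u}) : Prop :=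
  ∃ (F : DM 𝒮 a) (ε : DM.Hom F D), ε.IsMinimalFreeResolution ∧
    ∀ j, b j = Module.rank (ResField 𝒮) (F.fiberHomologyGr j)

/-- `D` is Betti-deficient: its total Betti number `∑ⱼ βⱼ(D)` is strictly smaller than that of its
homology `H(D)`, the latter being viewed as a differential module with zero differential. -/
def DM.BettiDeficient (D : DM 𝒮 a) : Prop :=
  ∃ b b' : ℤ → Cardinal.{u}, D.HasBetti b ∧ D.H.HasBetti b' ∧ Cardinal.sum b < Cardinal.sum b'

end DiffMod

/-! The regular sequence yields a Koszul resolution of $S/I$, with basis vectors labelled by subsets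
$T\subseteq\{1,\dots,\ell\}$. Give the vector labelled $T$ the degree $\sum_{r\in T}d_r-a|T|$, so
that the Koszul differential has degree $a$. Any differential module with homology $S/I$ then has a
free resolution on the same basis, whose differential is minus the Koszul one plus homogeneous terms
lowering $|T|$ by at least 2 (`exists_deformed_resolution`).

The matrix entry from $T$ to $T'$ with $|T|-|T'|=j\ge 2$ has degree zero exactly when the asserted
identity holds for $J_1=T'$, $J_2=T$. If the identity never holds, all these entries lie in the
graded maximal ideal, and so do the Koszul entries: the deformed resolution of $D$ is minimal.

A minimal homotopy projective resolution has the least fiber rank (`rank_baseChange_le`). Hence the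
Koszul rank is at most $\beta(D)$. The same comparison for $H(D)$, with the roles exchanged, gives
$\beta(H(D))\le$ the Koszul rank. So $D$ is not Betti-deficient. -/

namespace DiffMod

/-! ### Homotopy projective differential modules and comparison of resolutions (no grading). -/

section Homotopy

variable {R : Type u} [CommRing R]

/-- Every cycle of the endomorphism `e` is a boundary. -/
def IsAcyclic {Z : Type*} [AddCommGroup Z] [Module R Z] (e : Z →ₗ[R] Z) : Prop :=
  LinearMap.ker e ≤ LinearMap.range e

/-- Every chain map from `(F, d)` to an acyclic differential module is null-homotopic. -/
def IsHomotopyProjective {F : Type*} [AddCommGroup F] [Module R F] (d : F →ₗ[R] F) : Prop :=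
  ∀ (Z : Type u) [AddCommGroup Z] [Module R Z] (e : Z →ₗ[R] Z), IsAcyclic e →
    ∀ g : F →ₗ[R] Z, e ∘ₗ g = g ∘ₗ d → ∃ h : F →ₗ[R] Z, g = e ∘ₗ h + h ∘ₗ d

/-- The differential of the mapping cone of `ψ : (X, dX) → (Y, dY)`. -/
def cone {X Y : Type*} [AddCommGroup X] [Module R X] [AddCommGroup Y] [Module R Y]
    (dX : X →ₗ[R] X) (dY : Y →ₗ[R] Y) (ψ : X →ₗ[R] Y) : (Y × X) →ₗ[R] (Y × X) :=
  (dY.coprod ψ).prod (-(dX ∘ₗ LinearMap.snd R Y X))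

@[simp] theorem cone_apply {X Y : Type*} [AddCommGroup X] [Module R X] [AddCommGroup Y]
    [Module R Y] (dX : X →ₗ[R] X) (dY : Y →ₗ[R] Y) (ψ : X →ₗ[R] Y) (p : Y × X) :
    cone dX dY ψ p = (dY p.1 + ψ p.2, -dX p.2) := rfl

theorem IsAcyclic.neg {Z : Type*} [AddCommGroup Z] [Module R Z] {e : Z →ₗ[R] Z}
    (h : IsAcyclic e) : IsAcyclic (-e) := by
  intro x hx
  obtain ⟨y, rfl⟩ := h (x := x) (by simpa using hx)
  exact ⟨-y, by simp⟩

/-- A module with a basis weighted by natural numbers, such that the differential strictly lowers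
weights, is homotopy projective. -/
theorem isHomotopyProjective_of_basis {F ι : Type*} [AddCommGroup F] [Module R F]
    (d : F →ₗ[R] F) (hd : d ∘ₗ d = 0) (b : Module.Basis ι R F) (w : ι → ℕ)
    (hw : ∀ i j, w i ≤ w j → b.repr (d (b i)) j = 0) : IsHomotopyProjective d := by
  classical
  intro Z _ _ e he g hg
  -- The homotopy is built by recursion on the weight, solving $e(y_i)=g(b_i)-h(d\,b_i)$.
  -- Solvability is not available during the recursion, so `epsilon` picks a junk value if needed;
  -- `key` shows afterwards that a solution always exists.
  let y : ι → Z := (measure w).wf.fix fun i prev =>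
    Classical.epsilon fun y => e y = g (b i) - (b.repr (d (b i))).sum fun j c =>
      c • (if h : w j < w i then prev j h else 0)
  have hy : ∀ i, y i = Classical.epsilon fun z => e z = g (b i) - b.constr R y (d (b i)) := by
    intro i
    have := (measure w).wf.fix_eq (C := fun _ => Z) (fun i prev =>
      Classical.epsilon fun y => e y = g (b i) - (b.repr (d (b i))).sum fun j c =>
        c • (if h : w j < w i then prev j h else 0)) i
    refine this.trans ?_
    congr! 4 with z
    rw [Module.Basis.constr_apply]
    refine Finsupp.sum_congr fun j hj => ?_
    have : w j < w i := by
      by_contra h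
      exact Finsupp.mem_support_iff.1 hj (hw i j (not_lt.1 h))
    rw [dif_pos this]
  set h := b.constr R y with hh
  have hb : ∀ i, h (b i) = y i := fun i => b.constr_basis R y i
  have key : ∀ n i, w i < n → e (h (b i)) = g (b i) - h (d (b i)) := by
    intro n
    induction n with
    | zero => intro i hi; omega
    | succ n ih =>
      intro i hi
      have hlow : e (h (d (b i))) = g (d (b i)) - h (d (d (b i))) := by
        have hx : ∀ x : F, (∀ j, n ≤ w j → b.repr x j = 0) →
            e (h x) = g x - h (d x) := by
          intro x hx
          conv_lhs => rw [← b.linearCombination_repr x]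
          conv_rhs => rw [← b.linearCombination_repr x]
          simp only [Finsupp.linearCombination_apply, Finsupp.sum, map_sum, map_smul]
          rw [← Finset.sum_sub_distrib]
          refine Finset.sum_congr rfl fun j hj => ?_
          rw [ih j (by by_contra hn; exact Finsupp.mem_support_iff.1 hj (hx j (not_lt.1 hn))),
            smul_sub]
        exact hx _ fun j hj => hw i j (by omega)
      have hdd : d (d (b i)) = 0 := LinearMap.congr_fun hd (b i)
      have hgd : e (g (b i)) = g (d (b i)) := LinearMap.congr_fun hg (b i)
      have hcyc : g (b i) - h (d (b i)) ∈ LinearMap.ker e := by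
        rw [LinearMap.mem_ker, map_sub, hlow, hdd, hgd]
        simp
      have hex : ∃ z, e z = g (b i) - h (d (b i)) := he hcyc
      rw [hb i, hy i]
      exact Classical.epsilon_spec hex
  refine ⟨h, b.ext fun i => ?_⟩
  simp [key _ i (Nat.lt_succ_self _)]

/-- Needed because a minimal free resolution is only required to be a summand of a free flag. -/
theorem IsHomotopyProjective.of_retract {F M : Type*} [AddCommGroup F] [Module R F]
    [AddCommGroup M] [Module R M] {d : F →ₗ[R] F} (hF : IsHomotopyProjective d)
    {d' : M →ₗ[R] M} (i : M →ₗ[R] F) (r : F →ₗ[R] M) (hi : d ∘ₗ i = i ∘ₗ d')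
    (hr : d' ∘ₗ r = r ∘ₗ d) (hri : r ∘ₗ i = LinearMap.id) : IsHomotopyProjective d' := by
  intro Z _ _ e he g hg
  obtain ⟨h, hh⟩ := hF Z e he (g ∘ₗ r) (by
    rw [← LinearMap.comp_assoc, hg, LinearMap.comp_assoc, hr, LinearMap.comp_assoc])
  refine ⟨h ∘ₗ i, ?_⟩
  calc g = (g ∘ₗ r) ∘ₗ i := by rw [LinearMap.comp_assoc, hri, LinearMap.comp_id]
    _ = _ := by
      rw [hh, LinearMap.add_comp, LinearMap.comp_assoc, LinearMap.comp_assoc, hi,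
        LinearMap.comp_assoc]

variable {X Y : Type u} [AddCommGroup X] [Module R X] [AddCommGroup Y] [Module R Y]
  {dX : X →ₗ[R] X} {dY : Y →ₗ[R] Y} {ψ : X →ₗ[R] Y}

/-- The chain map $(g,0)$ into the acyclic cone is null-homotopic. The two components of the
null-homotopy are the homotopy and the lift. -/
theorem IsHomotopyProjective.exists_lift {F : Type*} [AddCommGroup F] [Module R F]
    {d : F →ₗ[R] F} (hF : IsHomotopyProjective d) (hψ : IsAcyclic (cone dX dY ψ))
    (g : F →ₗ[R] Y) (hg : dY ∘ₗ g = g ∘ₗ d) :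
    ∃ (g' : F →ₗ[R] X) (h : F →ₗ[R] Y), dX ∘ₗ g' = g' ∘ₗ d ∧
      g = ψ ∘ₗ g' + (dY ∘ₗ h + h ∘ₗ d) := by
  obtain ⟨h, hh⟩ := hF (Y × X) _ hψ (g.prod 0) (by
    ext x
    · simpa using LinearMap.congr_fun hg x
    · simp)
  refine ⟨LinearMap.snd R Y X ∘ₗ h, LinearMap.fst R Y X ∘ₗ h, ?_, ?_⟩
  · ext x
    have : (0 : X) = -dX (h x).2 + (h (d x)).2 :=
      congrArg Prod.snd (LinearMap.congr_fun hh x)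
    simpa using neg_add_eq_zero.1 this.symm
  · ext x
    have : g x = dY (h x).1 + ψ (h x).2 + (h (d x)).1 :=
      congrArg Prod.fst (LinearMap.congr_fun hh x)
    simp only [LinearMap.add_apply, LinearMap.comp_apply, LinearMap.snd_apply,
      LinearMap.fst_apply, this]
    abel

/-- Here $(-h,g)$ is a chain map into the cone with negated differential; the negation turns its
component $-d_X$ into $d_X$. -/
theorem IsHomotopyProjective.homotopic_zero {F : Type*} [AddCommGroup F] [Module R F]
    {d : F →ₗ[R] F} (hF : IsHomotopyProjective d) (hψ : IsAcyclic (cone dX dY ψ))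
    (g : F →ₗ[R] X) (hg : dX ∘ₗ g = g ∘ₗ d) (h : F →ₗ[R] Y)
    (hh : ψ ∘ₗ g = dY ∘ₗ h + h ∘ₗ d) : ∃ k : F →ₗ[R] X, g = dX ∘ₗ k + k ∘ₗ d := by
  obtain ⟨k, hk⟩ := hF (Y × X) _ hψ.neg ((-h).prod g) (by
    ext x
    · have := LinearMap.congr_fun hh x
      simp only [LinearMap.add_apply, LinearMap.comp_apply] at this
      simp [this]
    · simpa using LinearMap.congr_fun hg x)
  refine ⟨LinearMap.snd R Y X ∘ₗ k, ?_⟩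
  ext x
  have := congrArg Prod.snd (LinearMap.congr_fun hk x)
  simpa using this

/-- A minimal homotopy projective resolution of `(E, dE)` has at most the fiber rank of any
other homotopy projective resolution. -/
theorem rank_baseChange_le {E : Type u} [AddCommGroup E] [Module R E] {dE : E →ₗ[R] E}
    (k : Type u) [CommRing k] [Algebra R k]
    (hX : IsHomotopyProjective dX) (hY : IsHomotopyProjective dY)
    {α : X →ₗ[R] E} {β : Y →ₗ[R] E} (hα : dE ∘ₗ α = α ∘ₗ dX) (hβ : dE ∘ₗ β = β ∘ₗ dY)
    (hcα : IsAcyclic (cone dX dE α)) (hcβ : IsAcyclic (cone dY dE β))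
    (hmin : dX.baseChange k = 0) :
    Module.rank k (TensorProduct R k X) ≤ Module.rank k (TensorProduct R k Y) := by
  -- Comparison maps $p:X\to Y$ and $q:Y\to X$ over $E$, with $qp$ homotopic to the identity.
  obtain ⟨p, s, hp, hps⟩ := hX.exists_lift hcβ α hα
  obtain ⟨q, t, hq, hqt⟩ := hY.exists_lift hcα β hβ
  obtain ⟨m, hm⟩ := hX.homotopic_zero hcα (LinearMap.id - q ∘ₗ p)
    (by rw [LinearMap.comp_sub, LinearMap.sub_comp, ← LinearMap.comp_assoc, hq,
          LinearMap.comp_assoc, hp]; rfl) (s + t ∘ₗ p) (by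
      ext x
      have h1 := LinearMap.congr_fun hps x
      have h2 := LinearMap.congr_fun hqt (p x)
      have h3 := LinearMap.congr_fun hp x
      simp only [LinearMap.add_apply, LinearMap.comp_apply, LinearMap.sub_apply, map_add,
        LinearMap.id_apply, map_sub] at *
      rw [h1, h2, h3]
      abel)
  -- Both terms of the homotopy contain $d_X$, which vanishes after base change, so $p\otimes k$ is
  -- a split injection.
  have h1 : q.baseChange k ∘ₗ p.baseChange k = LinearMap.id := by
    have := congrArg (LinearMap.baseChange k) hm
    rw [LinearMap.baseChange_sub, LinearMap.baseChange_add, LinearMap.baseChange_comp,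
      LinearMap.baseChange_comp, LinearMap.baseChange_comp, hmin, LinearMap.zero_comp,
      LinearMap.comp_zero, add_zero, LinearMap.baseChange_id] at this
    exact (sub_eq_zero.1 this).symm
  refine LinearMap.rank_le_of_injective (p.baseChange k) ?_
  exact Function.LeftInverse.injective (g := q.baseChange k) fun x => LinearMap.congr_fun h1 x

/-- The cone of a quasi-isomorphism is acyclic. -/
theorem isAcyclic_cone_of_bijective (h : dY ∘ₗ ψ = ψ ∘ₗ dX)
    (hb : Function.Bijective (homologyMap dX dY ψ h)) : IsAcyclic (cone dX dY ψ) := by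
  rintro ⟨y, x⟩ hyx
  rw [LinearMap.mem_ker, cone_apply, Prod.mk_eq_zero] at hyx
  obtain ⟨h1, h2⟩ := hyx
  simp only [neg_eq_zero] at h1 h2
  -- The cycle condition gives $\psi(x)=d_Y(-y)$, so injectivity on homology makes $x$ a boundary
  -- $d_X x'$; surjectivity then handles the cycle $y+\psi(x')$.
  have hx0 : homologyMk dX ⟨x, h2⟩ = 0 := by
    apply hb.1
    rw [map_zero]
    refine (Submodule.Quotient.mk_eq_zero _).2 ?_
    exact ⟨-y, by simpa [neg_eq_iff_add_eq_zero] using h1⟩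
  obtain ⟨x', hx'⟩ := (Submodule.Quotient.mk_eq_zero _).1 hx0
  replace hx' : dX x' = x := hx'
  have hcyc : y + ψ x' ∈ LinearMap.ker dY := by
    have := LinearMap.congr_fun h x'
    simp only [LinearMap.comp_apply] at this
    rw [LinearMap.mem_ker, map_add, this, hx', h1]
  obtain ⟨c, hc⟩ := hb.2 (homologyMk dY ⟨_, hcyc⟩)
  obtain ⟨⟨c, hc0⟩, rfl⟩ := Submodule.mkQ_surjective _ c
  obtain ⟨y', hy'⟩ := (Submodule.Quotient.eq _).1 hc
  replace hy' : dY y' = ψ c - (y + ψ x') := hy'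
  replace hc0 : dX c = 0 := hc0
  refine ⟨(-y', c - x'), ?_⟩
  rw [cone_apply]
  ext
  · simp only [map_neg, hy', map_sub]; abel
  · simp [hc0, hx']

end Homotopy

/-! ### Graded components, fibers over the residue field, and Betti numbers as ranks. -/

section Fiber

variable {S : Type u} [CommRing S] (𝒮 : ℕ → AddSubgroup S) [GradedRing 𝒮]

/-- The projection of an `ℕ`-graded ring on its component of degree `m : ℤ`. -/
def zproj (m : ℤ) : S →+ S := if 0 ≤ m then GradedRing.proj 𝒮 m.toNat else 0

theorem zproj_of_mem (m : ℤ) {n : ℕ} {s : S} (hs : s ∈ 𝒮 n) :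
    zproj 𝒮 m s = if m = n then s else 0 := by
  unfold zproj
  split_ifs with h1 h2 h2
  · have : m.toNat = n := by omega
    rw [this, GradedRing.proj_apply, DirectSum.decompose_of_mem_same _ hs]
  · rw [GradedRing.proj_apply, DirectSum.decompose_of_mem_ne _ hs (by omega)]
  · omega
  · rfl

theorem zproj_mem_gradedMaximalIdeal [IsLocalRing (𝒮 0)] {m : ℤ} (hm : m ≠ 0) (s : S) :
    zproj 𝒮 m s ∈ gradedMaximalIdeal 𝒮 := by
  have h0 : GradedRing.projZeroRingHom' 𝒮 (zproj 𝒮 m s) = 0 := by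
    apply Subtype.ext
    change (DirectSum.decompose 𝒮 (zproj 𝒮 m s) 0 : S) = 0
    unfold zproj
    split_ifs with h
    · rw [GradedRing.proj_apply]
      exact DirectSum.decompose_of_mem_ne _ (SetLike.coe_mem _) (by omega)
    · simp
  rw [gradedMaximalIdeal, Ideal.mem_comap, h0]
  exact zero_mem _

theorem gradedMaximalIdeal_ne_top [IsLocalRing (𝒮 0)] : gradedMaximalIdeal 𝒮 ≠ ⊤ :=
  Ideal.comap_ne_top _ (IsLocalRing.maximalIdeal.isMaximal (𝒮 0)).ne_top

theorem mem_gradedMaximalIdeal_of_not_isUnit [IsLocalRing (𝒮 0)] {n : ℕ} {s : S} (hs : s ∈ 𝒮 n)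
    (hu : ¬ IsUnit s) : s ∈ gradedMaximalIdeal 𝒮 := by
  by_cases hn : n = 0
  · subst hn
    rw [gradedMaximalIdeal, Ideal.mem_comap, IsLocalRing.mem_maximalIdeal, mem_nonunits_iff]
    intro h
    apply hu
    have h1 : ((GradedRing.projZeroRingHom' 𝒮 s : 𝒮 0) : S) = s :=
      DirectSum.decompose_of_mem_same _ hs
    rw [← h1]
    exact h.map (algebraMap (𝒮 0) S)
  · have := zproj_mem_gradedMaximalIdeal 𝒮 (m := n) (by exact_mod_cast hn) s
    rwa [zproj_of_mem 𝒮 _ hs, if_pos rfl] at this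

/-- Rank counts below only involve free modules, so a nontrivial commutative ring is enough. -/
instance [IsLocalRing (𝒮 0)] : Nontrivial (ResField 𝒮) :=
  Ideal.Quotient.nontrivial_iff.2 (gradedMaximalIdeal_ne_top 𝒮)

variable {𝒮} {a : ℤ}

open scoped Classical in
/-- The projection of a graded differential module on its component of degree `n`. -/
noncomputable def DM.proj (D : DM 𝒮 a) (n : ℤ) : D.carrier →+ D.carrier :=
  let _ := D.isInternal.chooseDecomposition
  { toFun := fun x => (DirectSum.decompose D.gr x n : D.carrier)
    map_zero' := by simp
    map_add' := by intro x y; simp [DirectSum.decompose_add] }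

omit [GradedRing 𝒮] in
theorem DM.proj_mem (D : DM 𝒮 a) (n : ℤ) (x : D.carrier) : D.proj n x ∈ D.gr n := by
  classical
  let _ := D.isInternal.chooseDecomposition
  exact SetLike.coe_mem (DirectSum.decompose D.gr x n)

omit [GradedRing 𝒮] in
theorem DM.proj_of_mem (D : DM 𝒮 a) (n : ℤ) {m : ℤ} {x : D.carrier} (hx : x ∈ D.gr m) :
    D.proj n x = if n = m then x else 0 := by
  classical
  let _ := D.isInternal.chooseDecomposition
  split_ifs with h
  · subst h
    exact DirectSum.decompose_of_mem_same _ hx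
  · exact DirectSum.decompose_of_mem_ne _ hx (Ne.symm h)

omit [GradedRing 𝒮] in
theorem DM.induction (D : DM 𝒮 a) {p : D.carrier → Prop} (h0 : p 0)
    (hom : ∀ n, ∀ x ∈ D.gr n, p x) (add : ∀ x y, p x → p y → p (x + y)) (x : D.carrier) : p x := by
  classical
  let _ := D.isInternal.chooseDecomposition
  exact DirectSum.Decomposition.inductionOn D.gr h0 (fun m => hom _ m m.2) add x

omit [GradedRing 𝒮] in
theorem DM.proj_d (D : DM 𝒮 a) (n : ℤ) (x : D.carrier) :
    D.proj (n + a) (D.d x) = D.d (D.proj n x) := by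
  induction x using D.induction with
  | h0 => simp
  | hom m x hx =>
    rw [D.proj_of_mem _ (D.d_mem _ _ hx), D.proj_of_mem _ hx]
    by_cases h : n = m
    · simp [h]
    · rw [if_neg h, if_neg (by omega), map_zero]
  | add x y hx hy => simp [hx, hy]

theorem DM.proj_smul (D : DM 𝒮 a) (n : ℤ) {m : ℤ} {x : D.carrier} (hx : x ∈ D.gr m) (s : S) :
    D.proj n (s • x) = zproj 𝒮 (n - m) s • x := by
  induction s using DirectSum.Decomposition.inductionOn 𝒮 with
  | zero => simp
  | @homogeneous i s =>
    rw [zproj_of_mem 𝒮 _ s.2, D.proj_of_mem _ (D.smul_mem _ _ _ _ s.2 hx)]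
    by_cases h : n = i + m
    · rw [if_pos h, if_pos (by omega)]
    · rw [if_neg h, if_neg (by omega), zero_smul]
  | add s t hs ht => simp [add_smul, hs, ht]

variable [IsLocalRing (𝒮 0)]

theorem one_tmul_smul_eq_zero {N : Type*} [AddCommGroup N] [Module S N] {s : S}
    (hs : s ∈ gradedMaximalIdeal 𝒮) (x : N) :
    (1 : ResField 𝒮) ⊗ₜ[S] (s • x) = 0 := by
  have : s • (1 : ResField 𝒮) = 0 := by
    rw [Algebra.smul_def, mul_one]
    exact Ideal.Quotient.eq_zero_iff_mem.2 hs
  rw [TensorProduct.tmul_smul, TensorProduct.smul_tmul', this, TensorProduct.zero_tmul]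

/-- The coefficients of an element of degree $n$ may be taken homogeneous of degree $n-\deg i$. When
this is nonzero they lie in the graded maximal ideal and die in the fiber. -/
theorem DM.fiberGr_eq_span (M : DM 𝒮 a) {ι : Type*} (v : Module.Basis ι S M.carrier)
    (deg : ι → ℤ) (hv : ∀ i, v i ∈ M.gr (deg i)) (n : ℤ) :
    M.fiberGr n = Submodule.span (ResField 𝒮)
      (Set.range fun i : {i // deg i = n} => v.baseChange (ResField 𝒮) i.1) := by
  apply le_antisymm
  · refine Submodule.span_le.2 ?_
    rintro _ ⟨x, hx, rfl⟩
    have h1 : x = (v.repr x).sum fun i s => zproj 𝒮 (n - deg i) s • v i := by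
      conv_lhs => rw [← if_pos (c := n = n) (t := x) (e := 0) rfl, ← M.proj_of_mem n hx,
        ← v.linearCombination_repr x, Finsupp.linearCombination_apply, Finsupp.sum, map_sum]
      exact Finset.sum_congr rfl fun i _ => M.proj_smul n (hv i) _
    dsimp only
    rw [h1, Finsupp.sum, TensorProduct.tmul_sum]
    refine Submodule.sum_mem _ fun i _ => ?_
    by_cases hi : deg i = n
    · have h2 : (1 : ResField 𝒮) ⊗ₜ[S] (zproj 𝒮 (n - deg i) (v.repr x i) • v i)
        = (algebraMap S (ResField 𝒮) (zproj 𝒮 (n - deg i) (v.repr x i))) •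
            v.baseChange (ResField 𝒮) i := by
        rw [Module.Basis.baseChange_apply, TensorProduct.tmul_smul, algebraMap_smul]
      rw [h2]
      exact Submodule.smul_mem _ _ (Submodule.subset_span ⟨⟨i, hi⟩, rfl⟩)
    · rw [one_tmul_smul_eq_zero (zproj_mem_gradedMaximalIdeal 𝒮 (by omega) _)]
      exact zero_mem _
  · refine Submodule.span_le.2 ?_
    rintro _ ⟨⟨i, rfl⟩, rfl⟩
    refine Submodule.subset_span ⟨v i, hv i, ?_⟩
    simp

theorem DM.rank_fiberHomologyGr (M : DM 𝒮 a) (hmin : M.IsMinimal) (n : ℤ) :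
    Module.rank (ResField 𝒮) (M.fiberHomologyGr n) = Module.rank (ResField 𝒮) (M.fiberGr n) := by
  have hker : LinearMap.ker M.fiberD = ⊤ := by
    rw [show M.fiberD = 0 from hmin, LinearMap.ker_zero]
  have hinj : Function.Injective (homologyMk M.fiberD) := by
    refine (injective_iff_map_eq_zero _).2 ?_
    rintro ⟨x, hx⟩ h
    obtain ⟨y, hy⟩ := (Submodule.Quotient.mk_eq_zero _).1 h
    replace hy : M.fiberD y = x := hy
    rw [show M.fiberD = 0 from hmin] at hy
    exact Subtype.ext hy.symm
  refine (LinearEquiv.rank_eq (Submodule.equivMapOfInjective _ hinj _)).symm.trans ?_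
  exact LinearEquiv.rank_eq (Submodule.submoduleOfEquivOfLe (hker ▸ le_top))

/-- The total Betti number computed from a minimal graded free module is its fiber rank. -/
theorem DM.sum_rank_fiberHomologyGr (M : DM 𝒮 a) (hfree : M.GradedFree ⊤) (hmin : M.IsMinimal) :
    Cardinal.sum (fun j => Module.rank (ResField 𝒮) (M.fiberHomologyGr j))
      = Module.rank (ResField 𝒮) (TensorProduct S (ResField 𝒮) M.carrier) := by
  obtain ⟨B, hB, hli, hspan⟩ := hfree
  choose deg hdeg using fun i : B => hB i i.2
  replace hli : LinearIndependent S (fun i : B => (i : M.carrier)) := hli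
  let v : Module.Basis B S M.carrier := Module.Basis.mk hli
    (by rw [Subtype.range_coe]; exact hspan.ge)
  have hv : ∀ i, v i ∈ M.gr (deg i) := fun i => by
    rw [show v i = (i : M.carrier) from Module.Basis.mk_apply hli _ i]
    exact hdeg i
  have h1 : ∀ n, Module.rank (ResField 𝒮) (M.fiberHomologyGr n)
      = Cardinal.mk {i // deg i = n} := by
    intro n
    have hl : LinearIndependent (ResField 𝒮)
        (fun i : {i // deg i = n} => v.baseChange (ResField 𝒮) i.1) :=
      (v.baseChange (ResField 𝒮)).linearIndependent.comp _ Subtype.val_injective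
    rw [M.rank_fiberHomologyGr hmin, M.fiberGr_eq_span v deg hv, rank_span hl,
      Cardinal.mk_range_eq _ hl.injective]
  simp_rw [h1]
  rw [← Cardinal.mk_sigma, Cardinal.mk_congr (Equiv.sigmaFiberEquiv deg),
    (v.baseChange (ResField 𝒮)).mk_eq_rank'']

omit [GradedRing 𝒮] [IsLocalRing (𝒮 0)] in
/-- A free flag is homotopy projective. -/
theorem DM.IsFreeFlag.isHomotopyProjective {F : DM 𝒮 a} (hF : F.IsFreeFlag) :
    IsHomotopyProjective F.d := by
  classical
  obtain ⟨P, hP, hfree, hd⟩ := hF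
  choose B _ hli hspan using hfree
  let v : ∀ i, Module.Basis (B i) S (P i) := fun i =>
    (Module.Basis.span (hli i)).map (LinearEquiv.ofEq _ _ (by
      rw [← hspan i]
      exact congrArg _ Subtype.range_coe))
  let b := hP.collectedBasis v
  have hb : ∀ i, b i ∈ P i.1 := fun i => by simp [b]
  -- The weight of a basis vector is its index in the flag.
  refine isHomotopyProjective_of_basis F.d F.d_comp_d b (fun i => i.1) ?_
  intro i j hij
  have hle : (⨆ k < i.1, P k) ≤ LinearMap.ker (b.coord j) := by
    refine iSup₂_le fun k hk x hx => ?_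
    rw [LinearMap.mem_ker, Module.Basis.coord_apply]
    exact hP.collectedBasis_repr_of_mem_ne v (i := k) (by omega) hx
  exact hle (hd i.1 ⟨b i, hb i, rfl⟩)

theorem DM.Hom.IsMinimalFreeResolution.isHomotopyProjective {M D : DM 𝒮 a} {ε : DM.Hom M D}
    (h : ε.IsMinimalFreeResolution) : IsHomotopyProjective M.d := by
  obtain ⟨-, -, -, F, φ, i, r, hF, -, hri, -⟩ := h
  exact hF.isHomotopyProjective.of_retract i.toLin r.toLin i.comm r.comm hri

end Fiber
-- The Koszul resolution as an iterated mapping cone.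
section Koszul

variable {S : Type u} [CommRing S] (𝒮 : ℕ → AddSubgroup S) [GradedRing 𝒮]
  [IsLocalRing (𝒮 0)]

/-- `(K, ∂)` is a minimal homogeneous free resolution of `S / I`, with a basis indexed by `ι` whose
members have the weight and the degree of the monomials `T i` of the exterior algebra. -/
structure IsKoszulResolution {ℓ : ℕ} (d : Fin ℓ → ℕ) (I : Ideal S) {ι : Type}
    {K : Type u} [AddCommGroup K] [Module S K] (T : ι → Finset (Fin ℓ)) (i₀ : ι)
    (b : Module.Basis ι S K) (δ : K →ₗ[S] K) : Prop where
  eq_empty_iff : ∀ i, T i = ∅ ↔ i = i₀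
  mem_maximal : ∀ i j, b.repr (δ (b i)) j ∈ gradedMaximalIdeal 𝒮
  homogeneous : ∀ i j, b.repr (δ (b i)) j = 0 ∨ ((T i).card = (T j).card + 1 ∧
    ∃ m : ℕ, b.repr (δ (b i)) j ∈ 𝒮 m ∧ ∑ r ∈ T i, d r = m + ∑ r ∈ T j, d r)
  sq : ∀ x, δ (δ x) = 0
  exact : ∀ x, δ x = 0 → ∃ (y : K) (s : S), x = δ y + s • b i₀
  mem_range_iff : ∀ s : S, s • b i₀ ∈ LinearMap.range δ ↔ s ∈ I

variable {𝒮}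

/-- One Koszul step: the cone of multiplication by $g$, regular modulo $I$, resolves $S/I'$ with
$I'=I+(g)$. The second copy of the basis carries the extra index $r$. -/
theorem IsKoszulResolution.cone {ℓ : ℕ} {d : Fin ℓ → ℕ} {I : Ideal S} {ι : Type}
    {K : Type u} [AddCommGroup K] [Module S K] {T : ι → Finset (Fin ℓ)} {i₀ : ι}
    {b : Module.Basis ι S K} {δ : K →ₗ[S] K} (h : IsKoszulResolution 𝒮 d I T i₀ b δ)
    (r : Fin ℓ) (hr : ∀ i, r ∉ T i) (g : S) (hg : g ∈ 𝒮 (d r)) (hgm : g ∈ gradedMaximalIdeal 𝒮)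
    (hreg : ∀ s, g * s ∈ I → s ∈ I) (I' : Ideal S) (hI' : ∀ t, t ∈ I' ↔ ∃ s, t + s * g ∈ I) :
    IsKoszulResolution 𝒮 d I' (Sum.elim T fun i => insert r (T i)) (Sum.inl i₀) (b.prod b)
      (DiffMod.cone δ δ (g • LinearMap.id)) where
  eq_empty_iff := by
    rintro (i | i)
    · simp [h.eq_empty_iff]
    · simp
  mem_maximal := by
    classical
    rintro (i | i) (j | j)
    · simpa using h.mem_maximal i j
    · simp
    · simp only [Module.Basis.prod_apply, Sum.elim_inr, Function.comp_apply, cone_apply,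
        LinearMap.inr_apply, map_zero, zero_add, Module.Basis.prod_repr_inl]
      by_cases hij : i = j
      · simpa [hij] using hgm
      · simp [hij]
    · simpa using h.mem_maximal i j
  homogeneous := by
    classical
    rintro (i | i) (j | j)
    · simpa using h.homogeneous i j
    · left; simp
    · by_cases hij : i = j
      · subst hij
        right
        refine ⟨by simp [Finset.card_insert_of_notMem (hr i)], d r, ?_, ?_⟩
        · simpa using hg
        · simp [Finset.sum_insert (hr i)]
      · left; simp [hij]
    · rcases h.homogeneous i j with h0 | ⟨h1, m, h2, h3⟩
      · left; simpa using h0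
      · right
        refine ⟨by simp [Finset.card_insert_of_notMem (hr _), h1], m, by simpa using h2, ?_⟩
        simp only [Sum.elim_inr, Finset.sum_insert (hr _), h3]
        ring
  sq := by
    rintro ⟨x, y⟩
    simp [h.sq]
  exact := by
    rintro ⟨x, y⟩ hxy
    simp only [cone_apply, LinearMap.smul_apply, LinearMap.id_apply, Prod.mk_eq_zero,
      neg_eq_zero] at hxy
    obtain ⟨hx, hy⟩ := hxy
    obtain ⟨y', s, rfl⟩ := h.exact y hy
    -- Since $g\,y$ is a boundary, so is $gs\,b_{i_0}$; regularity of $g$ modulo $I$ then removes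
    -- the class of $y$.
    have hs : s ∈ I := by
      refine hreg s ((h.mem_range_iff _).1 ⟨-(x + g • y'), ?_⟩)
      rw [map_neg, map_add, map_smul, mul_smul, ← sub_eq_zero, ← neg_eq_zero, ← hx, smul_add]
      abel
    obtain ⟨y'', hy''⟩ := (h.mem_range_iff s).2 hs
    obtain ⟨x', t, hx'⟩ := h.exact (x + g • (y' + y'')) (by
      rw [map_add, map_smul, map_add, hy'', hx])
    refine ⟨(x', -(y' + y'')), t, ?_⟩
    have hx2 : x = δ x' + t • b i₀ - g • (y' + y'') := eq_sub_of_add_eq hx'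
    ext
    · simp only [cone_apply, Module.Basis.prod_apply, Sum.elim_inl, Function.comp_apply, hx2,
        LinearMap.inl_apply, Prod.fst_add, Prod.smul_fst, LinearMap.smul_apply,
        LinearMap.id_apply, smul_neg]
      abel
    · simp [hy'']
  mem_range_iff := by
    intro t
    rw [hI']
    constructor
    · rintro ⟨⟨x, y⟩, hxy⟩
      simp only [cone_apply, LinearMap.smul_apply, LinearMap.id_apply, Module.Basis.prod_apply,
        Sum.elim_inl, Function.comp_apply, LinearMap.inl_apply, Prod.smul_mk, smul_zero,
        Prod.mk.injEq, neg_eq_zero] at hxy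
      obtain ⟨hx, hy⟩ := hxy
      obtain ⟨y', s, rfl⟩ := h.exact y hy
      refine ⟨-s, (h.mem_range_iff _).1 ⟨x + g • y', ?_⟩⟩
      rw [add_smul, ← hx, map_add, map_smul, smul_add, neg_mul, neg_smul, mul_comm s g, mul_smul]
      abel
    · rintro ⟨s, hs⟩
      obtain ⟨x, hx⟩ := (h.mem_range_iff _).2 hs
      refine ⟨(x, -(s • b i₀)), ?_⟩
      have h0 : δ (b i₀) = 0 := by
        refine b.repr.injective (Finsupp.ext fun j => ?_)
        rcases h.homogeneous i₀ j with h0 | ⟨h1, -⟩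
        · simpa using h0
        · rw [(h.eq_empty_iff i₀).2 rfl] at h1
          simp at h1
      ext
      · simp only [cone_apply, hx, LinearMap.smul_apply, LinearMap.id_apply, smul_neg,
          Module.Basis.prod_apply, Sum.elim_inl, Function.comp_apply, LinearMap.inl_apply,
          Prod.smul_mk, add_smul, smul_smul, mul_comm g s]
        abel
      · simp [h0]

theorem exists_isKoszulResolution {ℓ : ℕ} (f : Fin ℓ → S) (d : Fin ℓ → ℕ)
    (hf : ∀ i, f i ∈ 𝒮 (d i)) (hm : ∀ i, f i ∈ gradedMaximalIdeal 𝒮)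
    (hreg : ∀ k s, f k * s ∈ Ideal.span (f '' {i | i < k}) → s ∈ Ideal.span (f '' {i | i < k})) :
    ∃ (ι : Type) (_ : Fintype ι) (K : Type u) (_ : AddCommGroup K) (_ : Module S K)
      (T : ι → Finset (Fin ℓ)) (i₀ : ι) (b : Module.Basis ι S K) (δ : K →ₗ[S] K),
      IsKoszulResolution 𝒮 d (Ideal.span (Set.range f)) T i₀ b δ := by
  suffices H : ∀ n ≤ ℓ, ∃ (ι : Type) (_ : Fintype ι) (K : Type u) (_ : AddCommGroup K)
      (_ : Module S K) (T : ι → Finset (Fin ℓ)) (i₀ : ι) (b : Module.Basis ι S K)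
      (δ : K →ₗ[S] K), (∀ i, ∀ r ∈ T i, (r : ℕ) < n) ∧
      IsKoszulResolution 𝒮 d (Ideal.span (f '' {i | (i : ℕ) < n})) T i₀ b δ by
    obtain ⟨ι, h1, K, h2, h3, T, i₀, b, δ, -, h⟩ := H ℓ le_rfl
    refine ⟨ι, h1, K, h2, h3, T, i₀, b, δ, ?_⟩
    convert h using 2
    ext x
    simp
  intro n
  induction n with
  | zero =>
    intro _
    refine ⟨Unit, inferInstance, S, inferInstance, inferInstance, fun _ => ∅, (),
      Module.Basis.singleton Unit S, 0, by simp, ?_⟩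
    exact
      { eq_empty_iff := by simp
        mem_maximal := by simp
        homogeneous := by simp
        sq := by simp
        exact := fun x _ => ⟨0, x, by simp⟩
        mem_range_iff := by simp }
  | succ n ih =>
    intro hn
    obtain ⟨ι, h1, K, h2, h3, T, i₀, b, δ, hT, h⟩ := ih (by omega)
    let r : Fin ℓ := ⟨n, hn⟩
    -- The strict bound carried through the induction makes the new index fresh, so each `insert`
    -- raises the cardinality by one.
    have hr : ∀ i, r ∉ T i := fun i hi => lt_irrefl n (hT i r hi)
    refine ⟨ι ⊕ ι, inferInstance, K × K, inferInstance, inferInstance, _, _, _, _, ?_,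
      h.cone r hr (f r) (hf r) (hm r) (hreg r) _ ?_⟩
    · rintro (i | i) s hs
      · exact (hT i s hs).trans (Nat.lt_succ_self n)
      · rcases Finset.mem_insert.1 hs with rfl | hs
        · exact Nat.lt_succ_self n
        · exact (hT i s hs).trans (Nat.lt_succ_self n)
    · intro t
      have : {i : Fin ℓ | (i : ℕ) < n + 1} = insert r {i : Fin ℓ | (i : ℕ) < n} := by
        ext i
        simp only [Set.mem_ofPred_eq, Set.mem_insert_iff, Fin.ext_iff, r]
        omega
      rw [this, Set.image_insert_eq, Ideal.mem_span_insert']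

/-- A regular sequence of homogeneous elements lies in the graded maximal ideal. -/
theorem mem_gradedMaximalIdeal_of_isRegular {ℓ : ℕ} (f : Fin ℓ → S) (d : Fin ℓ → ℕ)
    (hf : ∀ i, f i ∈ 𝒮 (d i)) (hreg : RingTheory.Sequence.IsRegular S (List.ofFn f)) (i : Fin ℓ) :
    f i ∈ gradedMaximalIdeal 𝒮 := by
  refine mem_gradedMaximalIdeal_of_not_isUnit 𝒮 (hf i) fun hu => hreg.top_ne_smul ?_
  have : Ideal.ofList (List.ofFn f) = ⊤ :=
    Ideal.eq_top_of_isUnit_mem _ (Ideal.subset_span (by simp)) hu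
  rw [this]
  simp

omit [IsLocalRing (𝒮 0)] in
theorem mem_span_of_mul_mem_of_isRegular {ℓ : ℕ} (f : Fin ℓ → S)
    (hreg : RingTheory.Sequence.IsRegular S (List.ofFn f)) (k : Fin ℓ) (s : S)
    (hs : f k * s ∈ Ideal.span (f '' {i | i < k})) : s ∈ Ideal.span (f '' {i | i < k}) := by
  have hI : Ideal.ofList ((List.ofFn f).take k) = Ideal.span (f '' {i | i < k}) := by
    refine congrArg Ideal.span (Set.ext fun x => ?_)
    simp only [List.mem_take_iff_getElem, List.getElem_ofFn, List.length_ofFn, lt_inf_iff,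
      Set.mem_ofPred_eq, Set.mem_image]
    constructor
    · rintro ⟨i, hi, rfl⟩
      exact ⟨⟨i, hi.2⟩, hi.1, rfl⟩
    · rintro ⟨i, hi, rfl⟩
      exact ⟨i, ⟨hi, i.2⟩, rfl⟩
  have h := hreg.toIsWeaklyRegular.regular_mod_prev k (by simp)
  rw [List.getElem_ofFn] at h
  have hJ : (Ideal.ofList ((List.ofFn f).take k) • ⊤ : Submodule S S)
      = Ideal.span (f '' {i | i < k}) := by rw [hI]; simp
  rw [hJ] at h
  have h0 := (isSMulRegular_iff_right_eq_zero_of_smul.1 h)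
    (Submodule.Quotient.mk s) ((Submodule.Quotient.mk_eq_zero _).2 hs)
  exact (Submodule.Quotient.mk_eq_zero _).1 h0

end Koszul
-- Killing homology weight by weight: extending a differential by free generators.
section Twist

variable {S : Type u} [CommRing S] {ι : Type} [Fintype ι] {E : Type u} [AddCommGroup E] [Module S E]

/-- The endomorphism of `E × (ι → S)` that is `d` on `E` and sends the basis vector `i` to
`v i`. -/
def twist (d : E →ₗ[S] E) (v : ι → E × (ι → S)) : (E × (ι → S)) →ₗ[S] (E × (ι → S)) :=
  (LinearMap.inl S E (ι → S) ∘ₗ d).coprod (Fintype.linearCombination S v)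

theorem twist_apply (d : E →ₗ[S] E) (v : ι → E × (ι → S)) (p : E × (ι → S)) :
    twist d v p = (d p.1, 0) + ∑ i, p.2 i • v i := rfl

theorem twist_fst (d : E →ₗ[S] E) (v : ι → E × (ι → S)) (p : E × (ι → S)) :
    (twist d v p).1 = d p.1 + ∑ i, p.2 i • (v i).1 := by
  simp [twist_apply, Prod.fst_sum]

theorem twist_snd (d : E →ₗ[S] E) (v : ι → E × (ι → S)) (p : E × (ι → S)) (j : ι) :
    (twist d v p).2 j = ∑ i, p.2 i * (v i).2 j := by
  simp [twist_apply, Prod.snd_sum]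

theorem twist_twist {d : E →ₗ[S] E} (hd : d ∘ₗ d = 0) {v : ι → E × (ι → S)}
    (hv : ∀ i, twist d v (v i) = 0) (p : E × (ι → S)) : twist d v (twist d v p) = 0 := by
  have hdd : d (d p.1) = 0 := LinearMap.congr_fun hd _
  rw [twist_apply d v p, map_add, map_sum]
  simp only [map_smul, hv, smul_zero, Finset.sum_const_zero, add_zero]
  simp [twist_apply, hdd]

/-- The component of weight `n` of a vector. -/
def weightPart (w : ι → ℕ) (n : ℕ) : (ι → S) →ₗ[S] (ι → S) where
  toFun x j := if w j = n then x j else 0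
  map_add' x y := by ext j; by_cases h : w j = n <;> simp [h]
  map_smul' s x := by ext j; by_cases h : w j = n <;> simp [h]

omit [Fintype ι] in
@[simp] theorem weightPart_apply (w : ι → ℕ) (n : ℕ) (x : ι → S) (j : ι) :
    weightPart w n x j = if w j = n then x j else 0 := rfl

/-- The rows `c` form the matrix of a differential that lowers weights by one, exact away from the
unique basis vector `i₀` of weight zero. -/
structure IsWeightedResolution [DecidableEq ι] (w : ι → ℕ) (i₀ : ι) (c : ι → ι → S) : Prop where
  weight_eq_zero_iff : ∀ i, w i = 0 ↔ i = i₀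
  weight_eq : ∀ i j, w i ≠ w j + 1 → c i j = 0
  sq : ∀ x, Fintype.linearCombination S c (Fintype.linearCombination S c x) = 0
  exact : ∀ x, Fintype.linearCombination S c x = 0 →
    ∃ (y : ι → S) (s : S), x = Fintype.linearCombination S c y + s • Pi.single i₀ 1

variable [DecidableEq ι] {w : ι → ℕ} {i₀ : ι} {c : ι → ι → S}

namespace IsWeightedResolution

theorem weightPart_comm (h : IsWeightedResolution w i₀ c) (n : ℕ) (x : ι → S) :
    Fintype.linearCombination S c (weightPart w (n + 1) x)
      = weightPart w n (Fintype.linearCombination S c x) := by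
  ext j
  simp only [Fintype.linearCombination_apply, Finset.sum_apply, Pi.smul_apply, smul_eq_mul,
    weightPart_apply]
  by_cases hj : w j = n
  · rw [if_pos hj]
    refine Finset.sum_congr rfl fun i _ => ?_
    by_cases hi : w i = n + 1
    · rw [if_pos hi]
    · rw [h.weight_eq i j (by omega), mul_zero, mul_zero]
  · rw [if_neg hj]
    refine Finset.sum_eq_zero fun i _ => ?_
    by_cases hi : w i = n + 1
    · rw [h.weight_eq i j (by omega), mul_zero]
    · rw [if_neg hi, zero_mul]

theorem mem_range_of_weightPart (h : IsWeightedResolution w i₀ c) (n : ℕ) (x : ι → S)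
    (hx : Fintype.linearCombination S c (weightPart w (n + 1) x) = 0) :
    weightPart w (n + 1) x ∈ LinearMap.range (Fintype.linearCombination S c) := by
  obtain ⟨y, s, hy⟩ := h.exact _ hx
  -- Passing to the part of weight $n+2$ discards the error term at $i_0$, which has weight zero.
  refine ⟨weightPart w (n + 2) y, ?_⟩
  rw [h.weightPart_comm, eq_sub_of_add_eq hy.symm, map_sub]
  ext j
  by_cases hj : w j = n + 1
  · have : j ≠ i₀ := fun h0 => by rw [← h.weight_eq_zero_iff] at h0; omega
    simp [hj, this]
  · simp [hj]

end IsWeightedResolution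

/-- The rows `v` extend the matrix `c` to a differential on `E × (ι → S)` in weights at most `n`,
in such a way that its homology in these weights is the kernel of the differential of `c` in
weight `n`. -/
structure IsStage (d : E →ₗ[S] E) (w : ι → ℕ) (c : ι → ι → S) (n : ℕ)
    (v : ι → E × (ι → S)) : Prop where
  eq_zero : ∀ i, n < w i → v i = 0
  lower : ∀ i j, w i ≤ w j → (v i).2 j = 0
  leading : ∀ i j, w i ≤ n → w i = w j + 1 → (v i).2 j = c i j
  cycle : ∀ i, twist d v (v i) = 0
  mem_range : ∀ p, twist d v p = 0 → (∀ j, n < w j → p.2 j = 0) →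
    weightPart w n p.2 ∈ LinearMap.range (Fintype.linearCombination S c)
  lift : ∀ k, weightPart w n k ∈ LinearMap.range (Fintype.linearCombination S c) →
    ∃ p, twist d v p = 0 ∧ (∀ j, n < w j → p.2 j = 0) ∧ weightPart w n p.2 = weightPart w n k
  exact : ∀ p, twist d v p = 0 → (∀ j, n < w j → p.2 j = 0) → weightPart w n p.2 = 0 →
    ∃ q, (∀ j, n < w j → q.2 j = 0) ∧ p = twist d v q

/-- Sending the generator of weight zero to $z$ kills the homology of $E$. What remains is the
annihilator of the class of $z$, which `hann` identifies with the boundaries of `c` in weight zero.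
-/
theorem IsStage.zero (h : IsWeightedResolution w i₀ c) {d : E →ₗ[S] E} (z : E) (hz : d z = 0)
    (hgen : ∀ x, d x = 0 → ∃ (y : E) (s : S), x = d y + s • z)
    (hann : ∀ s : S, s • z ∈ LinearMap.range d ↔
      s • (Pi.single i₀ 1 : ι → S) ∈ LinearMap.range (Fintype.linearCombination S c)) :
    IsStage d w c 0 (Pi.single i₀ (z, 0)) := by
  have ht : ∀ p : E × (ι → S), twist d (Pi.single i₀ (z, 0)) p = (d p.1 + p.2 i₀ • z, 0) := by
    intro p
    rw [twist_apply, Finset.sum_eq_single i₀]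
    · simp
    · intro i _ hi
      simp [hi]
    · simp
  have hw0 : w i₀ = 0 := (h.weight_eq_zero_iff _).2 rfl
  have hpart : ∀ x : ι → S, weightPart w 0 x = x i₀ • Pi.single i₀ 1 := by
    intro x
    ext j
    by_cases hj : j = i₀
    · subst hj; simp [hw0]
    · simp [hj, h.weight_eq_zero_iff]
  have hsnd : ∀ i, (Pi.single i₀ (z, 0) : ι → E × (ι → S)) i = if i = i₀ then (z, 0) else 0 :=
    fun i => Pi.single_apply _ _ _
  refine ⟨?_, ?_, ?_, ?_, ?_, ?_, ?_⟩
  · intro i hi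
    have : i ≠ i₀ := fun h0 => by rw [← h.weight_eq_zero_iff] at h0; omega
    simp [this]
  · intro i j _
    rw [hsnd]
    split_ifs <;> rfl
  · intro i j h1 h2; omega
  · intro i
    rw [ht, hsnd]
    split_ifs <;> simp [hz]
  · intro p hp _
    rw [hpart, ← hann]
    rw [ht, Prod.mk_eq_zero] at hp
    refine ⟨-p.1, ?_⟩
    rw [map_neg]
    exact neg_eq_of_add_eq_zero_right hp.1
  · intro k hk
    rw [hpart, ← hann] at hk
    obtain ⟨y, hy⟩ := hk
    refine ⟨(-y, k i₀ • Pi.single i₀ 1), ?_, ?_, ?_⟩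
    · simp [ht, hy]
    · intro j hj
      have : j ≠ i₀ := fun h0 => by rw [← h.weight_eq_zero_iff] at h0; omega
      simp [this]
    · simp [hpart]
  · intro p hp hp0 hp1
    have hp2 : p.2 = 0 := by
      ext j
      by_cases hj : w j = 0
      · simpa [hj] using congrFun hp1 j
      · exact hp0 j (by omega)
    rw [ht, Prod.mk_eq_zero, hp2] at hp
    obtain ⟨y, s, hy⟩ := hgen p.1 (by simpa using hp.1)
    refine ⟨(y, s • Pi.single i₀ 1), ?_, ?_⟩
    · intro j hj
      have : j ≠ i₀ := fun h0 => by rw [← h.weight_eq_zero_iff] at h0; omega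
      simp [this]
    · rw [ht]
      ext
      · simp [hy]
      · simp [hp2]

/-- The new generators are attached to cycles whose top parts are the rows of `c`, and these
generate the homology left at stage $n$. The new homology comes from syzygies among the rows, which
are boundaries of `c` by exactness. -/
theorem IsStage.succ (h : IsWeightedResolution w i₀ c) {d : E →ₗ[S] E} (hd : d ∘ₗ d = 0) {n : ℕ}
    {v : ι → E × (ι → S)} (hv : IsStage d w c n v) (u : ι → E × (ι → S))
    (hu : ∀ i, w i = n + 1 → twist d v (u i) = 0 ∧ (∀ j, n < w j → (u i).2 j = 0) ∧
      ∀ j, w j = n → (u i).2 j = c i j) :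
    IsStage d w c (n + 1) (fun i => if w i = n + 1 then u i else v i) := by
  set v' : ι → E × (ι → S) := fun i => if w i = n + 1 then u i else v i with hv'
  have hpos : ∀ i, w i = n + 1 → v' i = u i := fun i hi => if_pos hi
  have hneg : ∀ i, w i ≠ n + 1 → v' i = v i := fun i hi => if_neg hi
  have hT : ∀ p : E × (ι → S), (∀ j, n < w j → p.2 j = 0) → twist d v' p = twist d v p := by
    intro p hp
    rw [twist_apply, twist_apply]
    congr 1
    refine Finset.sum_congr rfl fun i _ => ?_
    by_cases hi : w i = n + 1
    · rw [hp i (by omega), zero_smul, zero_smul]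
    · rw [hneg i hi]
  have hlow : ∀ i j, w i ≤ w j → (v' i).2 j = 0 := by
    intro i j hij
    by_cases hi : w i = n + 1
    · rw [hpos i hi]; exact (hu i hi).2.1 j (by omega)
    · rw [hneg i hi]; exact hv.lower i j hij
  have hlead : ∀ i j, w i ≤ n + 1 → w i = w j + 1 → (v' i).2 j = c i j := by
    intro i j h1 h2
    by_cases hi : w i = n + 1
    · rw [hpos i hi]; exact (hu i hi).2.2 j (by omega)
    · rw [hneg i hi]; exact hv.leading i j (by omega) h2
  have hcyc : ∀ i, twist d v' (v' i) = 0 := by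
    intro i
    by_cases hi : w i = n + 1
    · rw [hpos i hi, hT _ (hu i hi).2.1]
      exact (hu i hi).1
    · rw [hneg i hi]
      by_cases hi' : n < w i
      · rw [hv.eq_zero i hi', map_zero]
      · rw [hT _ fun j hj => hv.lower i j (by omega)]
        exact hv.cycle i
  have hsupp : ∀ p : E × (ι → S), (∀ j, n + 1 < w j → p.2 j = 0) →
      ∀ j, n < w j → (twist d v' p).2 j = 0 := by
    intro p hp j hj
    rw [twist_snd]
    refine Finset.sum_eq_zero fun i _ => ?_
    by_cases hi : n + 1 < w i
    · rw [hp i hi, zero_mul]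
    · rw [hlow i j (by omega), mul_zero]
  have htop : ∀ p : E × (ι → S), (∀ j, n + 1 < w j → p.2 j = 0) →
      weightPart w n (twist d v' p).2
        = Fintype.linearCombination S c (weightPart w (n + 1) p.2) := by
    intro p hp
    rw [h.weightPart_comm]
    ext j
    rw [weightPart_apply, weightPart_apply]
    by_cases hj : w j = n
    · rw [if_pos hj, if_pos hj, twist_snd, Fintype.linearCombination_apply, Finset.sum_apply]
      refine Finset.sum_congr rfl fun i _ => ?_
      rw [Pi.smul_apply, smul_eq_mul]
      by_cases hi : w i = n + 1
      · rw [hlead i j (by omega) (by omega)]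
      · rw [h.weight_eq i j (by omega), mul_zero]
        by_cases hi' : n + 1 < w i
        · rw [hp i hi', zero_mul]
        · rw [hlow i j (by omega), mul_zero]
    · rw [if_neg hj, if_neg hj]
  refine ⟨?_, hlow, hlead, hcyc, ?_, ?_, ?_⟩
  · intro i hi
    rw [hneg i (by omega)]
    exact hv.eq_zero i (by omega)
  · intro p hp hp0
    refine h.mem_range_of_weightPart n _ ?_
    rw [← htop p hp0, hp]
    exact map_zero _
  · intro k ⟨m, hm⟩
    -- The twist of `k₀` is a cycle of weight at most $n$ whose top part vanishes because `c`
    -- squares to zero. Hence it bounds some `q` at stage $n$, and `k₀ - q` is the required cycle.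
    let k₀ : E × (ι → S) := (0, weightPart w (n + 1) k)
    have hk0 : ∀ j, n + 1 < w j → k₀.2 j = 0 := fun j hj => if_neg (by omega)
    have hidem : weightPart w (n + 1) k₀.2 = weightPart w (n + 1) k := by
      ext j
      by_cases hj : w j = n + 1 <;> simp [k₀, hj]
    obtain ⟨q, hq, hpq⟩ := hv.exact (twist d v' k₀)
      (by rw [← hT _ (hsupp k₀ hk0)]; exact twist_twist hd hcyc _) (hsupp k₀ hk0)
      (by rw [htop k₀ hk0, hidem, ← hm]; exact h.sq m)
    refine ⟨k₀ - q, ?_, ?_, ?_⟩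
    · rw [map_sub, hpq, hT q hq, sub_self]
    · intro j hj
      rw [Prod.snd_sub, Pi.sub_apply, hk0 j hj, hq j (by omega), sub_zero]
    · rw [Prod.snd_sub, map_sub, hidem]
      ext j
      by_cases hj : w j = n + 1
      · simp [hj, hq j (by omega)]
      · simp [hj]
  · intro p hp hp0 hp1
    have hpn : ∀ j, n < w j → p.2 j = 0 := by
      intro j hj
      by_cases hj' : w j = n + 1
      · simpa [hj'] using congrFun hp1 j
      · exact hp0 j (by omega)
    rw [hT p hpn] at hp
    -- Subtracting the twist of the weight $n+1$ part of `y` cancels the top part of `p`, so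
    -- exactness at stage $n$ applies to the difference.
    obtain ⟨y, hy⟩ := hv.mem_range p hp hpn
    let y₀ : E × (ι → S) := (0, weightPart w (n + 1) y)
    have hy0 : ∀ j, n + 1 < w j → y₀.2 j = 0 := fun j hj => if_neg (by omega)
    have hidem : weightPart w (n + 1) y₀.2 = weightPart w (n + 1) y := by
      ext j
      by_cases hj : w j = n + 1 <;> simp [y₀, hj]
    have hpp : weightPart w n (weightPart w n p.2) = weightPart w n p.2 := by
      ext j
      by_cases hj : w j = n <;> simp [hj]
    obtain ⟨q, hq, hpq⟩ := hv.exact (p - twist d v' y₀)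
      (by
        rw [map_sub, hp, ← hT _ (hsupp y₀ hy0), twist_twist hd hcyc, sub_zero])
      (fun j hj => by
        rw [Prod.snd_sub, Pi.sub_apply, hpn j hj, hsupp y₀ hy0 j hj, sub_zero])
      (by
        rw [Prod.snd_sub, map_sub, htop y₀ hy0, hidem, h.weightPart_comm, hy, hpp, sub_self])
    refine ⟨q + y₀, fun j hj => ?_, ?_⟩
    · rw [Prod.snd_add, Pi.add_apply, hq j (by omega), hy0 j hj, add_zero]
    · rw [map_add, hT q hq, ← hpq, sub_add_cancel]

end Twist
theorem homologyMk_eq_zero_iff {R M : Type*} [CommRing R] [AddCommGroup M] [Module R M]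
    (f : M →ₗ[R] M) (x : LinearMap.ker f) :
    homologyMk f x = 0 ↔ (x : M) ∈ LinearMap.range f :=
  Submodule.Quotient.mk_eq_zero _

/-! ### Homogeneous deformations of the resolution of the homology. -/

section Resolution

variable {S : Type u} [CommRing S] {𝒮 : ℕ → AddSubgroup S} [GradedRing 𝒮] {a : ℤ}

theorem zproj_mem_or_eq_zero (p : ℤ) (t : S) :
    (∃ n : ℕ, p = n ∧ zproj 𝒮 p t ∈ 𝒮 n) ∨ zproj 𝒮 p t = 0 := by
  unfold zproj
  split_ifs with h
  · exact Or.inl ⟨p.toNat, by omega, SetLike.coe_mem _⟩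
  · exact Or.inr rfl

theorem zproj_zproj (p : ℤ) (t : S) : zproj 𝒮 p (zproj 𝒮 p t) = zproj 𝒮 p t := by
  rcases zproj_mem_or_eq_zero (𝒮 := 𝒮) p t with ⟨n, rfl, h⟩ | h
  · rw [zproj_of_mem 𝒮 _ h, if_pos rfl]
  · rw [h, map_zero]

theorem zproj_mul (m p : ℤ) (s t : S) :
    zproj 𝒮 m (s * zproj 𝒮 p t) = zproj 𝒮 (m - p) s * zproj 𝒮 p t := by
  rcases zproj_mem_or_eq_zero (𝒮 := 𝒮) p t with ⟨n, rfl, h⟩ | h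
  · induction s using DirectSum.Decomposition.inductionOn 𝒮 with
    | zero => simp
    | @homogeneous i s =>
      rw [zproj_of_mem 𝒮 _ s.2, zproj_of_mem 𝒮 _ (SetLike.mul_mem_graded s.2 h)]
      push_cast
      by_cases h' : m = i + n
      · rw [if_pos h', if_pos (by omega)]
      · rw [if_neg h', if_neg (by omega), zero_mul]
    | add s s' hs hs' => simp [add_mul, hs, hs']
  · simp [h]

variable {ι : Type} [Fintype ι]

/-- The rows `v` are homogeneous of degree `a` when the basis vector `i` has degree `deg i`. -/
def IsHomogeneousRows (D : DM 𝒮 a) (deg : ι → ℤ) (v : ι → D.carrier × (ι → S)) : Prop :=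
  ∀ i, (v i).1 ∈ D.gr (deg i) ∧
    ∀ j, zproj 𝒮 (deg i + a - deg j) ((v i).2 j) = (v i).2 j

/-- The homogeneous component of degree `m` (`m - a` on the summand `D`). -/
noncomputable def coneProj (D : DM 𝒮 a) (deg : ι → ℤ) (m : ℤ) (p : D.carrier × (ι → S)) :
    D.carrier × (ι → S) :=
  (D.proj (m - a) p.1, fun j => zproj 𝒮 (m - deg j) (p.2 j))

/-- With $D$ shifted by $a$ inside the cone, homogeneous rows make the twisted differential
homogeneous of degree $a$. -/
theorem IsHomogeneousRows.twist_coneProj {D : DM 𝒮 a} {deg : ι → ℤ}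
    {v : ι → D.carrier × (ι → S)} (hv : IsHomogeneousRows D deg v) (m : ℤ)
    (p : D.carrier × (ι → S)) :
    twist D.d v (coneProj D deg m p) = coneProj D deg (m + a) (twist D.d v p) := by
  refine Prod.ext ?_ (funext fun j => ?_)
  · rw [twist_fst]
    simp only [coneProj]
    rw [twist_fst, map_add, map_sum, ← D.proj_d]
    congr 1
    · congr 2; ring
    · refine Finset.sum_congr rfl fun i _ => ?_
      rw [D.proj_smul _ (hv i).1]
      congr 3; ring
  · rw [twist_snd]
    simp only [coneProj]
    rw [twist_snd, map_sum]
    refine Finset.sum_congr rfl fun i _ => ?_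
    rw [← (hv i).2 j, zproj_mul]
    congr 3; ring

variable [DecidableEq ι] {w : ι → ℕ} {i₀ : ι} {c : ι → ι → S}

theorem exists_isStage (h : IsWeightedResolution w i₀ c) (D : DM 𝒮 a) (deg : ι → ℤ)
    (hdeg : deg i₀ = 0)
    (hc : ∀ i j, w i = w j + 1 → zproj 𝒮 (deg i + a - deg j) (c i j) = c i j)
    (z : D.carrier) (hz0 : z ∈ D.gr 0) (hz : D.d z = 0)
    (hgen : ∀ x, D.d x = 0 → ∃ (y : D.carrier) (s : S), x = D.d y + s • z)
    (hann : ∀ s : S, s • z ∈ LinearMap.range D.d ↔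
      s • (Pi.single i₀ 1 : ι → S) ∈ LinearMap.range (Fintype.linearCombination S c)) (n : ℕ) :
    ∃ v, IsStage D.d w c n v ∧ IsHomogeneousRows D deg v := by
  induction n with
  | zero =>
    refine ⟨_, IsStage.zero h z hz hgen hann, fun i => ?_⟩
    by_cases hi : i = i₀
    · subst hi
      simpa [hdeg] using hz0
    · simp [hi, zero_mem]
  | succ n ih =>
    obtain ⟨v, hv, hhom⟩ := ih
    have key : ∀ i, ∃ u : D.carrier × (ι → S), w i = n + 1 →
        ((twist D.d v u = 0 ∧ (∀ j, n < w j → u.2 j = 0) ∧ ∀ j, w j = n → u.2 j = c i j) ∧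
        (u.1 ∈ D.gr (deg i) ∧ ∀ j, zproj 𝒮 (deg i + a - deg j) (u.2 j) = u.2 j)) := by
      intro i
      by_cases hi : w i = n + 1
      swap
      · exact ⟨0, fun h => absurd h hi⟩
      have hci : weightPart w n (c i) = c i := by
        ext j
        by_cases hj : w j = n
        · simp [hj]
        · simp [hj, h.weight_eq i j (by omega)]
      obtain ⟨p, hp, hp0, hp1⟩ := hv.lift (c i) (by
        rw [hci]
        exact ⟨Pi.single i 1, by simp⟩)
      -- The cycle provided by `lift` need not be homogeneous. Its component of degree $\deg i+a$ is
      -- still a cycle and keeps the leading part, since `c i` is itself homogeneous.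
      refine ⟨coneProj D deg (deg i + a) p, fun _ => ⟨⟨?_, ?_, ?_⟩, ?_, ?_⟩⟩
      · rw [hhom.twist_coneProj, hp]
        refine Prod.ext ?_ (funext fun j => ?_) <;> simp [coneProj]
      · intro j hj
        simp [coneProj, hp0 j hj]
      · intro j hj
        have : p.2 j = c i j := by
          have := congrFun hp1 j
          rwa [hci, weightPart_apply, if_pos hj] at this
        simp only [coneProj]
        rw [this, hc i j (by omega)]
      · have := D.proj_mem (deg i + a - a) p.1
        rw [add_sub_cancel_right] at this
        simpa [coneProj] using this
      · intro j
        exact zproj_zproj _ _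
    choose u hu using key
    refine ⟨_, hv.succ h D.d_comp_d u fun i hi => (hu i hi).1, fun i => ?_⟩
    by_cases hi : w i = n + 1
    · rw [if_pos hi]; exact (hu i hi).2
    · rw [if_neg hi]; exact hhom i

/-- A differential module with cyclic homology has a free resolution that deforms a given
resolution of its homology. -/
theorem exists_deformed_resolution (h : IsWeightedResolution w i₀ c) (D : DM 𝒮 a) (deg : ι → ℤ)
    (hdeg : deg i₀ = 0)
    (hc : ∀ i j, w i = w j + 1 → zproj 𝒮 (deg i + a - deg j) (c i j) = c i j)
    (z : D.carrier) (hz0 : z ∈ D.gr 0) (hz : D.d z = 0)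
    (hgen : ∀ x, D.d x = 0 → ∃ (y : D.carrier) (s : S), x = D.d y + s • z)
    (hann : ∀ s : S, s • z ∈ LinearMap.range D.d ↔
      s • (Pi.single i₀ 1 : ι → S) ∈ LinearMap.range (Fintype.linearCombination S c)) :
    ∃ (m : ι → ι → S) (τ : (ι → S) →ₗ[S] D.carrier),
      IsHomotopyProjective (Fintype.linearCombination S m) ∧
      D.d ∘ₗ τ = τ ∘ₗ Fintype.linearCombination S m ∧
      IsAcyclic (cone (Fintype.linearCombination S m) D.d τ) ∧
      (∀ i j, w i ≤ w j → m i j = 0) ∧ (∀ i j, w i = w j + 1 → m i j = -c i j) ∧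
      ∀ i j, zproj 𝒮 (deg i + a - deg j) (m i j) = m i j := by
  obtain ⟨N, hN⟩ : ∃ N, ∀ i, w i < N :=
    ⟨Finset.univ.sup w + 1, fun i => Nat.lt_succ_of_le (Finset.le_sup (Finset.mem_univ i))⟩
  obtain ⟨v, hv, hhom⟩ := exists_isStage h D deg hdeg hc z hz0 hz hgen hann N
  -- The sign compensates for the $-d_X$ in `cone`, so that the cone of `τ` is literally the twisted
  -- differential.
  let m : ι → ι → S := fun i => -(v i).2
  let τ : (ι → S) →ₗ[S] D.carrier := Fintype.linearCombination S fun i => (v i).1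
  have hm : ∀ x j, (Fintype.linearCombination S m x) j = -∑ i, x i * (v i).2 j := by
    intro x j
    simp [m, Fintype.linearCombination_apply, Finset.sum_apply]
  have hcone : cone (Fintype.linearCombination S m) D.d τ = twist D.d v := by
    refine LinearMap.ext fun p => Prod.ext ?_ (funext fun j => ?_)
    · rw [twist_fst]; rfl
    · rw [twist_snd]
      exact (congrArg Neg.neg (hm p.2 j)).trans (neg_neg _)
  have hsq : ∀ p, cone (Fintype.linearCombination S m) D.d τ
      (cone (Fintype.linearCombination S m) D.d τ p) = 0 := fun p => by
    rw [hcone]; exact twist_twist D.d_comp_d hv.cycle p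
  refine ⟨m, τ, ?_, ?_, ?_, ?_, ?_, ?_⟩
  · refine isHomotopyProjective_of_basis _ ?_ (Pi.basisFun S ι) w ?_
    · refine LinearMap.ext fun x => ?_
      simpa using congrArg Prod.snd (hsq (0, x))
    · intro i j hij
      simp [m, hv.lower i j hij]
  · refine LinearMap.ext fun x => ?_
    have := congrArg Prod.fst (hsq (0, x))
    simpa [add_neg_eq_zero] using this
  · rw [hcone]
    intro p hp
    -- As $N$ exceeds every weight, both side conditions of stage $N$ hold trivially and no homology
    -- is left.
    obtain ⟨q, -, hq⟩ := hv.exact p hp (fun j hj => absurd hj (hN j).not_gt) (by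
      ext j
      simp [(hN j).ne])
    exact ⟨q, hq.symm⟩
  · intro i j hij
    simp [m, hv.lower i j hij]
  · intro i j hij
    simp [m, hv.leading i j (hN i).le hij]
  · intro i j
    simp [m, (hhom i).2 j]

variable [IsLocalRing (𝒮 0)]

omit [DecidableEq ι] in
theorem baseChange_linearCombination_eq_zero (m : ι → ι → S)
    (hm : ∀ i j, m i j ∈ gradedMaximalIdeal 𝒮) :
    (Fintype.linearCombination S m).baseChange (ResField 𝒮) = 0 := by
  classical
  refine LinearMap.ext fun t => ?_
  induction t with
  | zero => simp
  | add x y hx hy => rw [map_add, hx, hy]; simp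
  | tmul r x =>
    rw [LinearMap.baseChange_tmul, LinearMap.zero_apply, ← mul_one r, ← smul_eq_mul,
      ← TensorProduct.smul_tmul', pi_eq_sum_univ (Fintype.linearCombination S m x),
      TensorProduct.tmul_sum, Finset.sum_eq_zero, smul_zero]
    intro j _
    refine one_tmul_smul_eq_zero ?_ _
    rw [Fintype.linearCombination_apply, Finset.sum_apply]
    exact Ideal.sum_mem _ fun i _ => Ideal.mul_mem_left _ _ (hm i j)

omit [DecidableEq ι] [IsLocalRing (𝒮 0)] in
/-- A generating cycle of degree zero for a differential module with homology `S / I`. -/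
theorem DM.HomologyIso.exists_generator {D : DM 𝒮 a} {I : Ideal S} (h : D.HomologyIso I) :
    ∃ z ∈ D.gr 0, D.d z = 0 ∧
      (∀ x, D.d x = 0 → ∃ (y : D.carrier) (s : S), x = D.d y + s • z) ∧
      ∀ s : S, s • z ∈ LinearMap.range D.d ↔ s ∈ I := by
  obtain ⟨e, he⟩ := h
  have h1 : e.symm 1 ∈ D.H.gr 0 := by
    rw [he, e.apply_symm_apply]
    exact ⟨1, SetLike.one_mem_graded 𝒮, (Ideal.Quotient.mk I).map_one⟩
  obtain ⟨⟨z, hz⟩, hz0, hz1⟩ := h1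
  replace hz1 : homologyMk D.d ⟨z, hz⟩ = e.symm 1 := hz1
  refine ⟨z, hz0, hz, fun x hx => ?_, fun s => ?_⟩
  · obtain ⟨s, hs⟩ := Ideal.Quotient.mk_surjective (e (homologyMk D.d ⟨x, hx⟩))
    have h2 : homologyMk D.d ⟨x, hx⟩ = homologyMk D.d (s • ⟨z, hz⟩) := by
      apply e.injective
      rw [map_smul, hz1]
      refine hs.symm.trans ?_
      refine Eq.trans ?_ (e.map_smul s (e.symm 1)).symm
      rw [e.apply_symm_apply, Algebra.smul_def, mul_one]
      rfl
    obtain ⟨y, hy⟩ := (Submodule.Quotient.eq _).1 h2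
    replace hy : D.d y = x - s • z := hy
    exact ⟨y, s, by rw [hy]; abel⟩
  · have h2 : s • z ∈ LinearMap.range D.d ↔ homologyMk D.d (s • ⟨z, hz⟩) = 0 :=
      (homologyMk_eq_zero_iff D.d (s • ⟨z, hz⟩)).symm
    have h3 : e (homologyMk D.d (s • ⟨z, hz⟩)) = Ideal.Quotient.mk I s := by
      rw [map_smul, hz1]
      refine (e.map_smul s (e.symm 1)).trans ?_
      rw [e.apply_symm_apply, Algebra.smul_def, mul_one]
      rfl
    rw [h2, ← Ideal.Quotient.eq_zero_iff_mem, ← h3]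
    exact e.map_eq_zero_iff.symm

end Resolution
end DiffMod

/-! ### Degree count and comparison of Betti numbers. -/

open DiffMod in
theorem mainTheorem10 {S : Type u} [CommRing S] [IsNoetherianRing S]
    (𝒮 : ℕ → AddSubgroup S) [GradedRing 𝒮] [IsLocalRing (𝒮 0)]
    (ℓ : ℕ) (f : Fin ℓ → S) (d : Fin ℓ → ℕ) (hf : ∀ i, f i ∈ 𝒮 (d i))
    (hreg : RingTheory.Sequence.IsRegular S (List.ofFn f))
    (a : ℤ) (D : DiffMod.DM 𝒮 a)
    (hH : D.HomologyIso (Ideal.span (Set.range f)))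
    (hD : D.BettiDeficient) :
    ∃ (J₁ J₂ : Finset (Fin ℓ)) (j : ℕ), 2 ≤ j ∧ j ≤ ℓ ∧ J₂.card = J₁.card + j ∧
      (∑ r ∈ J₁, (d r : ℤ)) - ∑ r ∈ J₂, (d r : ℤ) = a - a * j := by
  classical
  by_contra hno
  obtain ⟨ι, _, K, _, _, T, i₀, b, δ, hK⟩ := exists_isKoszulResolution f d hf
    (mem_gradedMaximalIdeal_of_isRegular f d hf hreg) (mem_span_of_mul_mem_of_isRegular f hreg)
  let c : ι → ι → S := fun i => b.repr (δ (b i))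
  let w : ι → ℕ := fun i => (T i).card
  -- The shift by $-a|T|$ turns the Koszul differential, which preserves internal degree and lowers
  -- $|T|$ by one, into a map of degree $a$.
  let deg : ι → ℤ := fun i => ∑ r ∈ T i, (d r : ℤ) - a * (T i).card
  have hsingle : ∀ i, b.equivFun (b i) = Pi.single i 1 := fun i => by
    ext j
    rw [b.equivFun_self, Pi.single_apply]
    simp [eq_comm]
  have hδ : ∀ x, Fintype.linearCombination S c (b.equivFun x) = b.equivFun (δ x) := by
    intro x
    have : Fintype.linearCombination S c ∘ₗ b.equivFun.toLinearMap
        = b.equivFun.toLinearMap ∘ₗ δ := b.ext fun i => by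
      rw [LinearMap.comp_apply, LinearEquiv.coe_coe, hsingle,
        Fintype.linearCombination_apply_single, one_smul]
      rfl
    exact LinearMap.congr_fun this x
  have hone : ∀ s : S, b.equivFun (s • b i₀) = s • Pi.single i₀ 1 := by
    intro s
    rw [map_smul, hsingle]
  have hW : IsWeightedResolution w i₀ c :=
    { weight_eq_zero_iff := fun i => by rw [Finset.card_eq_zero, hK.eq_empty_iff]
      weight_eq := fun i j hij => (hK.homogeneous i j).resolve_right fun h => hij h.1
      sq := fun x => by
        obtain ⟨x, rfl⟩ := b.equivFun.surjective x
        rw [hδ, hδ, hK.sq, map_zero]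
      exact := fun x hx => by
        obtain ⟨x, rfl⟩ := b.equivFun.surjective x
        rw [hδ, b.equivFun.map_eq_zero_iff] at hx
        obtain ⟨y, s, rfl⟩ := hK.exact x hx
        exact ⟨b.equivFun y, s, by rw [hδ, map_add, hone]⟩ }
  have hrange : ∀ s : S, s • (Pi.single i₀ 1 : ι → S) ∈
      LinearMap.range (Fintype.linearCombination S c) ↔ s ∈ Ideal.span (Set.range f) := by
    intro s
    rw [← hK.mem_range_iff, ← hone]
    constructor
    · rintro ⟨x, hx⟩
      obtain ⟨x, rfl⟩ := b.equivFun.surjective x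
      rw [hδ] at hx
      exact ⟨x, b.equivFun.injective hx⟩
    · rintro ⟨x, hx⟩
      exact ⟨b.equivFun x, by rw [hδ, hx]⟩
  have hdeg : deg i₀ = 0 := by simp [deg, (hK.eq_empty_iff i₀).2 rfl]
  have hc : ∀ i j, w i = w j + 1 → zproj 𝒮 (deg i + a - deg j) (c i j) = c i j := by
    intro i j hij
    rcases hK.homogeneous i j with h0 | ⟨-, m, h1, h2⟩
    · rw [show c i j = 0 from h0, map_zero]
    · have h3 : ∑ r ∈ T i, (d r : ℤ) = m + ∑ r ∈ T j, (d r : ℤ) := by exact_mod_cast h2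
      have h4 : ((T i).card : ℤ) = (T j).card + 1 := by exact_mod_cast hij
      rw [zproj_of_mem 𝒮 _ h1, if_pos]
      simp only [deg, h3, h4]
      ring
  obtain ⟨z, hz0, hz, hgen, hann⟩ := hH.exists_generator
  obtain ⟨bD, bH, ⟨M, ε, hε, hbD⟩, ⟨M', ε', hε', hbH⟩, hlt⟩ := hD
  obtain ⟨m, τ, hm1, hm2, hm3, hm4, hm5, hm6⟩ := exists_deformed_resolution hW D deg hdeg hc z hz0
    hz hgen (fun s => (hann s).trans (hrange s).symm)
  obtain ⟨m', τ', hm1', hm2', hm3', -⟩ := exists_deformed_resolution hW D.H deg hdeg hc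
    (homologyMk D.d ⟨z, hz⟩) ⟨⟨z, hz⟩, hz0, rfl⟩ rfl
    (fun x _ => by
      obtain ⟨⟨x, hx⟩, rfl⟩ := Submodule.mkQ_surjective _ x
      obtain ⟨y, s, rfl⟩ := hgen x hx
      refine ⟨0, s, ?_⟩
      rw [map_zero, zero_add]
      exact (Submodule.Quotient.eq _).2 ⟨y, (add_sub_cancel_right _ _).symm⟩)
    (fun s => by
      rw [hrange, ← hann]
      have h2 : s • z ∈ LinearMap.range D.d ↔ homologyMk D.d (s • ⟨z, hz⟩) = 0 :=
        (homologyMk_eq_zero_iff D.d (s • ⟨z, hz⟩)).symm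
      rw [h2]
      exact ⟨fun ⟨_, h⟩ => h.symm, fun h => ⟨0, h.symm⟩⟩)
  have hmin : ∀ i j, m i j ∈ gradedMaximalIdeal 𝒮 := by
    intro i j
    rcases le_or_gt (w i) (w j) with hij | hij
    · rw [hm4 i j hij]; exact zero_mem _
    by_cases hij' : w i = w j + 1
    · rw [hm5 i j hij']; exact neg_mem (hK.mem_maximal i j)
    rw [← hm6 i j]
    -- Only entries dropping the weight by at least two remain. Such an entry could escape the ideal
    -- only in degree zero, which is the excluded identity.
    refine zproj_mem_gradedMaximalIdeal 𝒮 (fun h0 => hno ?_) _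
    have hcard : (T i).card ≤ ℓ := (Finset.card_le_univ _).trans_eq (Fintype.card_fin ℓ)
    refine ⟨T j, T i, w i - w j, by omega, (Nat.sub_le _ _).trans hcard,
      (Nat.add_sub_of_le hij.le).symm, ?_⟩
    rw [Nat.cast_sub hij.le]
    simp only [deg, w] at h0 ⊢
    linarith
  have h1 := rank_baseChange_le (ResField 𝒮) hm1 hε.isHomotopyProjective hm2 ε.comm hm3
    (isAcyclic_cone_of_bijective ε.comm hε.2.2.1) (baseChange_linearCombination_eq_zero m hmin)
  -- Here `M'` is the minimal side, so nothing about the minimality of `m'` is needed.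
  have h2 := rank_baseChange_le (ResField 𝒮) hε'.isHomotopyProjective hm1' ε'.comm hm2'
    (isAcyclic_cone_of_bijective ε'.comm hε'.2.2.1) hm3' hε'.2.1
  rw [← M.sum_rank_fiberHomologyGr hε.1 hε.2.1] at h1
  rw [← M'.sum_rank_fiberHomologyGr hε'.1 hε'.2.1] at h2
  rw [funext hbD, funext hbH] at hlt
  exact absurd (h2.trans h1) hlt.not_ge
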